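/- Let $d\ge 3$ be an odd integer and let $T$ be the $d$-regular rooted tree, whose vertices are the finite words over $X=\{1,\dots,d\}$, with the empty word as root and with the words $ux$ ($x\in X$) as the children of $u$. Let $\mathrm{Aut}(T)$ be the group of graph automorphisms of $T$ that fix the root. Let $G_d\le \mathrm{Aut}(T)$ be the subgroup generated by $a_1,\dots,a_d$, where, with indices and letters read modulo $d$, the $a_i$ are defined recursively on words by $$a_i(i\,v)=(i+1)\,a_i(v),\qquad a_i((i+1)\,v)=i\,a_{i+1}(v),\qquad a_i(x\,v)=x\,v\quad (x\ne i,i+1);$$ in other words, $a_i$ acts on the first level as the transposition $(i\ \,i+1)$, its sections at $i$ and $i+1$ are $a_i$ and $a_{i+1}$, and its other first-level sections are trivial. For $k\ge 0$ let $\mathrm{St}(k)$ denote the subgroup of the elements of $G_d$ that fix every word of length $k$. Then for every integer $k\ge 1$, $$[\mathrm{St}(k):\mathrm{St}(k+1)]=\frac{(d!)^{d^{k}}}{2^{d^{k-1}}}\qquad\text{and}\qquad [G_d:\mathrm{St}(k+1)]=\frac{(d!)^{\frac{d^{k+1}-1}{d-1}}}{2^{\frac{d^{k}-1}{d-1}}}.$$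 -/

import Mathlib

namespace TreeAut

/-- The `d`-regular rooted tree: its vertices are the finite words over the alphabet `Fin d`
(the letters `1, …, d` shifted to `0, …, d - 1`), its root is the empty word `[]`, and the children
of the word `u` are the words `u ++ [x]`. -/
def regularTree (d : ℕ) : SimpleGraph (List (Fin d)) where
  Adj u v := (∃ x, v = u ++ [x]) ∨ (∃ x, u = v ++ [x])
  symm := ⟨fun _ _ h => h.symm⟩
  loopless := ⟨fun u h => by
    rcases h with ⟨x, hx⟩ | ⟨x, hx⟩ <;> simpa using congrArg List.length hx⟩

/-- `Aut(T)`: the group of the graph automorphisms of the `d`-regular rooted tree that fix the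
root. The product is composition, `(g * h) u = g (h u)`. -/
def rootedAut (d : ℕ) : Subgroup (regularTree d ≃g regularTree d) where
  carrier := {g | g [] = []}
  one_mem' := rfl
  mul_mem' {g h} hg hh := by
    change g (h []) = []
    rw [show h [] = [] from hh]
    exact hg
  inv_mem' {g} hg := by
    change g.symm [] = []
    rw [RelIso.symm_apply_eq]
    exact (show g [] = [] from hg).symm

/-- Root-preserving automorphisms of the tree preserve the length of words. -/
theorem length_apply {d : ℕ} (g : rootedAut d) (u : List (Fin d)) :
    (g.1 u).length = u.length := by
  have hg : g.1 [] = [] := g.2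
  have key : ∀ n : ℕ, ∀ u : List (Fin d), u.length = n → (g.1 u).length = n := by
    intro n
    induction n using Nat.strong_induction_on with
    | _ n ih =>
      intro u hu
      rcases List.eq_nil_or_concat' u with rfl | ⟨p, x, rfl⟩
      · rw [hg]; exact hu
      · have hp : p.length + 1 = n := by simpa using hu
        have h1 := ih p.length (by omega) p rfl
        have hadj : (regularTree d).Adj (g.1 p) (g.1 (p ++ [x])) :=
          g.1.map_rel_iff.2 (Or.inl ⟨x, rfl⟩)
        rcases hadj with ⟨y, hy⟩ | ⟨y, hy⟩
        · rw [hy]; simp; omega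
        · exfalso
          have hl := congrArg List.length hy
          rw [h1] at hl
          rcases List.eq_nil_or_concat' p with rfl | ⟨q, z, rfl⟩
          · simp at hl
          · have h2 := ih q.length (by simp at hp; omega) q rfl
            have hadj' : (regularTree d).Adj (g.1 q) (g.1 (q ++ [z])) :=
              g.1.map_rel_iff.2 (Or.inl ⟨z, rfl⟩)
            rcases hadj' with ⟨t, ht⟩ | ⟨t, ht⟩
            · rw [hy] at ht
              have h3 := (List.append_inj' ht rfl).1
              have h4 := congrArg List.length (g.1.injective h3)
              simp at h4
            · have h5 := congrArg List.length ht
              rw [List.length_append, h2, h1] at h5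
              simp at h5
              omega
  exact key _ u rfl

/-- The `k`-th level stabilizer `St_G(k)` of a group `G` of automorphisms of the tree: the elements
of `G` that fix every word of length `k`. -/
def levelStabilizer {d : ℕ} (G : Subgroup (rootedAut d)) (k : ℕ) : Subgroup (rootedAut d) where
  carrier := {g | g ∈ G ∧ ∀ u : List (Fin d), u.length = k → g.1 u = u}
  one_mem' := ⟨G.one_mem, fun _ _ => rfl⟩
  mul_mem' {g h} hg hh := ⟨G.mul_mem hg.1 hh.1, fun u hu => by
    change g.1 (h.1 u) = u
    rw [hh.2 u hu, hg.2 u hu]⟩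
  inv_mem' {g} hg := ⟨G.inv_mem hg.1, fun u hu => by
    change g.1.symm u = u
    rw [RelIso.symm_apply_eq]
    exact (hg.2 u hu).symm⟩

theorem levelStabilizer_le {d : ℕ} (G : Subgroup (rootedAut d)) (k : ℕ) :
    levelStabilizer G k ≤ G := fun _ hg => hg.1

/-- Level stabilizers decrease with the level. -/
theorem levelStabilizer_succ_le {d : ℕ} [NeZero d] (G : Subgroup (rootedAut d)) (k : ℕ) :
    levelStabilizer G (k + 1) ≤ levelStabilizer G k := by
  intro g hg
  refine ⟨hg.1, fun u hu => ?_⟩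
  have h1 : g.1 (u ++ [0]) = u ++ [0] := hg.2 _ (by simp [hu])
  have hadj : (regularTree d).Adj (g.1 u) (g.1 (u ++ [0])) :=
    g.1.map_rel_iff.2 (Or.inl ⟨0, rfl⟩)
  rw [h1] at hadj
  rcases hadj with ⟨y, hy⟩ | ⟨y, hy⟩
  · exact ((List.append_inj' hy rfl).1).symm
  · have h2 := congrArg List.length hy
    rw [length_apply] at h2
    simp at h2

/-- The letter that follows `i` in the cyclic order, i.e. `i + 1` modulo `d`. -/
def next {d : ℕ} (i : Fin d) : Fin d := ⟨(i.val + 1) % d, Nat.mod_lt _ i.pos⟩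

/-- The action on words of the automorphism with the wreath recursion
`a_i = (e, …, e, a_i, a_{i+1}, e, …, e) (i  i+1)`, indices modulo `d`: the first letter `x` is moved
by the transposition `(i  i+1)`, and the rest of the word is moved by the section at `x`, which is
`a_x` if `x` is `i` or `i + 1`, and trivial otherwise. -/
def genFun {d : ℕ} (i : Fin d) : List (Fin d) → List (Fin d)
  | [] => []
  | x :: v => Equiv.swap i (next i) x :: (if x = i ∨ x = next i then genFun x v else v)

/-- The inverse of `genFun i`. -/
def genInv {d : ℕ} (i : Fin d) : List (Fin d) → List (Fin d)
  | [] => []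
  | y :: v => Equiv.swap i (next i) y ::
      (if Equiv.swap i (next i) y = i ∨ Equiv.swap i (next i) y = next i
        then genInv (Equiv.swap i (next i) y) v else v)

theorem genInv_genFun {d : ℕ} (u : List (Fin d)) (i : Fin d) : genInv i (genFun i u) = u := by
  induction u generalizing i with
  | nil => rfl
  | cons x v ih =>
    simp only [genFun, genInv, Equiv.swap_apply_self]
    split_ifs
    · rw [ih]
    · rfl

theorem genFun_genInv {d : ℕ} (u : List (Fin d)) (i : Fin d) : genFun i (genInv i u) = u := by
  induction u generalizing i with
  | nil => rfl
  | cons x v ih =>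
    simp only [genFun, genInv, Equiv.swap_apply_self]
    split_ifs
    · rw [ih]
    · rfl

theorem genFun_append {d : ℕ} (u : List (Fin d)) (i x : Fin d) :
    ∃ y, genFun i (u ++ [x]) = genFun i u ++ [y] := by
  induction u generalizing i with
  | nil => exact ⟨Equiv.swap i (next i) x, by simp [genFun]⟩
  | cons z v ih =>
    by_cases h : z = i ∨ z = next i
    · obtain ⟨y, hy⟩ := ih z
      exact ⟨y, by simp only [List.cons_append, genFun, if_pos h, hy]⟩
    · exact ⟨x, by simp only [List.cons_append, genFun, if_neg h]⟩

theorem genInv_append {d : ℕ} (u : List (Fin d)) (i x : Fin d) :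
    ∃ y, genInv i (u ++ [x]) = genInv i u ++ [y] := by
  induction u generalizing i with
  | nil => exact ⟨Equiv.swap i (next i) x, by simp [genInv]⟩
  | cons z v ih =>
    by_cases h : Equiv.swap i (next i) z = i ∨ Equiv.swap i (next i) z = next i
    · obtain ⟨y, hy⟩ := ih (Equiv.swap i (next i) z)
      exact ⟨y, by simp only [List.cons_append, genInv, if_pos h, hy]⟩
    · exact ⟨x, by simp only [List.cons_append, genInv, if_neg h]⟩

/-- The generator `a_i`, as a root-preserving automorphism of the tree. -/
def gen {d : ℕ} (i : Fin d) : rootedAut d :=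
  ⟨{ toFun := genFun i
     invFun := genInv i
     left_inv := fun u => genInv_genFun u i
     right_inv := fun u => genFun_genInv u i
     map_rel_iff' := by
      intro u v
      change (regularTree d).Adj (genFun i u) (genFun i v) ↔ (regularTree d).Adj u v
      constructor
      · rintro (⟨x, hx⟩ | ⟨x, hx⟩)
        · obtain ⟨y, hy⟩ := genInv_append (genFun i u) i x
          rw [← hx, genInv_genFun, genInv_genFun] at hy
          exact Or.inl ⟨y, hy⟩
        · obtain ⟨y, hy⟩ := genInv_append (genFun i v) i x
          rw [← hx, genInv_genFun, genInv_genFun] at hy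
          exact Or.inr ⟨y, hy⟩
      · rintro (⟨x, rfl⟩ | ⟨x, rfl⟩)
        · exact Or.inl (genFun_append u i x)
        · exact Or.inr (genFun_append v i x) }, rfl⟩

/-- The group `G_d ≤ Aut(T)` generated by `a_1, …, a_d`. -/
def groupG (d : ℕ) : Subgroup (rootedAut d) := Subgroup.closure (Set.range gen)

end TreeAut

namespace TreeAut

open Equiv
open scoped commutatorElement

variable {d : ℕ}

/-! Each `a_i` has exactly two nontrivial first-level sections, both acting on the first level as
transpositions. Hence, for every element of the group `G`, the signs of its first-level sections
multiply to 1 (`firstLevelSign_eq_one`). As sections of `G` lie in `G`, the labels of an element of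
`St(k)` on level `k ≥ 1` obey one parity condition for each vertex of level `k - 1`. The point is
that there are no other conditions (`labels_range`): `St(k)/St(k+1)` is then a product of `d^(k-1)`
copies of an index-2 subgroup of `Sym(d)^d`. The index in `G` follows by telescoping, since `G` acts
as `Sym(d)` on the first level.

Labels are realized inside the commutator subgroup `G'`, because `G'` contains `G' × ⋯ × G'`
(`mulSingle_mem_commutatorSections`): labels can be prescribed independently in the first-level
subtrees, and induction reduces to level one. The containment comes from elements of `St(1)` with an
arbitrary section at `x` and trivial sections off `{x, y}` (`pairSections_eq_top`): commuting two of
them whose supports meet only in `x` leaves a single section.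

Oddness of `d` enters by going once round the cycle of letters. It yields elements of `St(1)` with
exactly two odd sections (`exists_sgn_groupSec_eq`), self-replication (`isSection_self`), and the
fact that a normal subgroup containing every `a_{i+1} a_i` contains all even elements
(`mem_of_groupSgn_eq_one`). -/

/-! ### Root permutations and sections of tree automorphisms -/

theorem exists_apply_append_singleton (g : rootedAut d) (u : List (Fin d)) (x : Fin d) :
    ∃ y, g.1 (u ++ [x]) = g.1 u ++ [y] := by
  have hadj : (regularTree d).Adj (g.1 u) (g.1 (u ++ [x])) :=
    g.1.map_rel_iff.2 (Or.inl ⟨x, rfl⟩)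
  rcases hadj with h | ⟨y, hy⟩
  · exact h
  · have h := congrArg List.length hy
    rw [List.length_append, length_apply, length_apply] at h
    simp at h
    omega

theorem exists_apply_append (g : rootedAut d) (u v : List (Fin d)) :
    ∃ w, g.1 (u ++ v) = g.1 u ++ w := by
  induction v using List.reverseRecOn with
  | nil => exact ⟨[], by simp⟩
  | append_singleton v x ih =>
    obtain ⟨w, hw⟩ := ih
    obtain ⟨y, hy⟩ := exists_apply_append_singleton g (u ++ v) x
    exact ⟨w ++ [y], by rw [← List.append_assoc, hy, hw, List.append_assoc]⟩

theorem exists_apply_cons (g : rootedAut d) (x : Fin d) :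
    ∃ y, ∀ v, ∃ w, g.1 (x :: v) = y :: w := by
  obtain ⟨y, hy⟩ := List.length_eq_one_iff.1 (length_apply g [x])
  refine ⟨y, fun v => ?_⟩
  obtain ⟨w, hw⟩ := exists_apply_append g [x] v
  exact ⟨w, by rw [hy] at hw; exact hw⟩

/-- The map induced by an automorphism of the tree on the first level. -/
noncomputable def rootFun (g : rootedAut d) (x : Fin d) : Fin d := (exists_apply_cons g x).choose

theorem apply_cons_eq_tail (g : rootedAut d) (x : Fin d) (v : List (Fin d)) :
    g.1 (x :: v) = rootFun g x :: (g.1 (x :: v)).tail := by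
  obtain ⟨w, hw⟩ := (exists_apply_cons g x).choose_spec v
  rw [hw]
  rfl

theorem rootFun_eq {g : rootedAut d} {x y : Fin d} {v w : List (Fin d)}
    (h : g.1 (x :: v) = y :: w) : rootFun g x = y := by
  rw [apply_cons_eq_tail] at h
  exact (List.cons.inj h).1

theorem rootFun_mul (g h : rootedAut d) (x : Fin d) :
    rootFun (g * h) x = rootFun g (rootFun h x) := by
  refine rootFun_eq (v := []) (w := (g.1 (rootFun h x :: (h.1 [x]).tail)).tail) ?_
  change g.1 (h.1 [x]) = _
  rw [apply_cons_eq_tail h, apply_cons_eq_tail g]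
  rfl

/-- The permutation of the first level induced by an automorphism of the tree. -/
noncomputable def root (d : ℕ) : rootedAut d →* Perm (Fin d) :=
  MonoidHom.toHomPerm
    { toFun := rootFun
      map_one' := funext fun _ => rootFun_eq (v := []) (w := []) rfl
      map_mul' := fun g h => funext fun x => rootFun_mul g h x }

theorem root_apply (g : rootedAut d) (x : Fin d) : root d g x = rootFun g x := rfl

theorem adj_cons_iff (x : Fin d) (u v : List (Fin d)) :
    (regularTree d).Adj (x :: u) (x :: v) ↔ (regularTree d).Adj u v := by
  simp [regularTree]

theorem apply_tail_tail (g : rootedAut d) (x : Fin d) (v : List (Fin d)) :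
    (g⁻¹.1 (rootFun g x :: (g.1 (x :: v)).tail)).tail = v := by
  rw [← apply_cons_eq_tail]
  change (g.1.symm (g.1 (x :: v))).tail = v
  rw [RelIso.symm_apply_apply]
  rfl

theorem apply_tail_tail_inv (g : rootedAut d) (x : Fin d) (v : List (Fin d)) :
    (g.1 (x :: (g⁻¹.1 (rootFun g x :: v)).tail)).tail = v := by
  have h := apply_tail_tail g⁻¹ (rootFun g x) v
  rwa [inv_inv, ← rootFun_mul, inv_mul_cancel, ← root_apply, map_one] at h

/-- The section of an automorphism of the tree at a vertex of the first level. -/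
noncomputable def sec (g : rootedAut d) (x : Fin d) : rootedAut d :=
  ⟨{ toFun := fun v => (g.1 (x :: v)).tail
     invFun := fun v => (g⁻¹.1 (rootFun g x :: v)).tail
     left_inv := apply_tail_tail g x
     right_inv := apply_tail_tail_inv g x
     map_rel_iff' := by
      intro u v
      change (regularTree d).Adj (g.1 (x :: u)).tail (g.1 (x :: v)).tail ↔ _
      rw [← adj_cons_iff (rootFun g x), ← apply_cons_eq_tail, ← apply_cons_eq_tail,
        ← adj_cons_iff x u v]
      exact g.1.map_rel_iff }, by
    change (g.1 [x]).tail = []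
    have h := length_apply g [x]
    exact List.eq_nil_of_length_eq_zero (by simp [h])⟩

theorem apply_cons (g : rootedAut d) (x : Fin d) (v : List (Fin d)) :
    g.1 (x :: v) = root d g x :: (sec g x).1 v :=
  apply_cons_eq_tail g x v

theorem ext_apply {g h : rootedAut d} (H : ∀ u, g.1 u = h.1 u) : g = h :=
  Subtype.ext (RelIso.ext H)

theorem sec_mul (g h : rootedAut d) (x : Fin d) :
    sec (g * h) x = sec g (root d h x) * sec h x := by
  refine ext_apply fun v => ?_
  have h1 : (g * h).1 (x :: v) = g.1 (h.1 (x :: v)) := rfl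
  rw [apply_cons, apply_cons, apply_cons] at h1
  exact (List.cons.inj h1).2

@[simp]
theorem sec_one (x : Fin d) : sec (1 : rootedAut d) x = 1 := by
  have h := sec_mul (1 : rootedAut d) 1 x
  rw [map_one, one_mul, Perm.one_apply] at h
  exact left_eq_mul.1 h

theorem sec_inv (g : rootedAut d) (x : Fin d) :
    sec g⁻¹ x = (sec g ((root d g)⁻¹ x))⁻¹ := by
  have h := sec_mul g g⁻¹ x
  rw [mul_inv_cancel, sec_one, map_inv] at h
  exact (inv_eq_of_mul_eq_one_right h.symm).symm

/-- The section of an automorphism of the tree at a vertex. -/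
noncomputable def sectionAt : rootedAut d → List (Fin d) → rootedAut d
  | g, [] => g
  | g, x :: u => sectionAt (sec g x) u

theorem apply_append (g : rootedAut d) (u v : List (Fin d)) :
    g.1 (u ++ v) = g.1 u ++ (sectionAt g u).1 v := by
  induction u generalizing g with
  | nil => rw [show g.1 [] = [] from g.2]; rfl
  | cons x u ih => rw [List.cons_append, apply_cons, ih, apply_cons]; rfl

theorem sectionAt_mul (g h : rootedAut d) (u : List (Fin d)) :
    sectionAt (g * h) u = sectionAt g (h.1 u) * sectionAt h u := by
  induction u generalizing g h with
  | nil => rw [show h.1 [] = [] from h.2]; rfl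
  | cons x u ih =>
    rw [apply_cons]
    simp only [sectionAt]
    rw [sec_mul, ih]

theorem sectionAt_append (g : rootedAut d) (u v : List (Fin d)) :
    sectionAt g (u ++ v) = sectionAt (sectionAt g u) v := by
  induction u generalizing g with
  | nil => rfl
  | cons x u ih => exact ih _

/-! ### Generators and self-similarity of the group -/

theorem root_gen (i : Fin d) : root d (gen i) = swap i (next i) :=
  Equiv.ext fun _ => rootFun_eq (v := []) rfl

theorem sec_gen (i x : Fin d) :
    sec (gen i) x = if x = i ∨ x = next i then gen x else 1 := by
  refine ext_apply fun v => ?_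
  have h : (gen i).1 (x :: v) = _ := apply_cons (gen i) x v
  rw [show (gen i).1 (x :: v) = swap i (next i) x ::
    (if x = i ∨ x = next i then genFun x v else v) from rfl] at h
  rw [← (List.cons.inj h).2]
  split_ifs <;> rfl

theorem gen_mem (i : Fin d) : gen i ∈ groupG d := Subgroup.subset_closure ⟨i, rfl⟩

theorem sec_mem {g : rootedAut d} (hg : g ∈ groupG d) (x : Fin d) : sec g x ∈ groupG d := by
  induction hg using Subgroup.closure_induction generalizing x with
  | mem g hg =>
    obtain ⟨i, rfl⟩ := hg
    rw [sec_gen]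
    split_ifs
    exacts [gen_mem x, one_mem _]
  | one => rw [sec_one]; exact one_mem _
  | mul g h _ _ ihg ihh => rw [sec_mul]; exact mul_mem (ihg _) (ihh _)
  | inv g _ ih => rw [sec_inv]; exact inv_mem (ih _)

theorem sectionAt_mem {g : rootedAut d} (hg : g ∈ groupG d) (u : List (Fin d)) :
    sectionAt g u ∈ groupG d := by
  induction u generalizing g with
  | nil => exact hg
  | cons x u ih => exact ih (sec_mem hg x)

/-! ### The parity constraint -/

/-- The sign of the permutation of the first level. -/
noncomputable def sgn (d : ℕ) : rootedAut d →* ℤˣ := Perm.sign.comp (root d)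

/-- The product of the signs of the permutations at the vertices of the first level. -/
noncomputable def firstLevelSign (d : ℕ) : rootedAut d →* ℤˣ where
  toFun g := ∏ x, sgn d (sec g x)
  map_one' := by simp
  map_mul' g h := by
    simp only [sec_mul, map_mul, Finset.prod_mul_distrib]
    rw [Equiv.prod_comp (root d h) fun x => sgn d (sec g x)]

theorem next_ne (hd : 2 ≤ d) (i : Fin d) : next i ≠ i := by
  intro h
  have h1 : (i.val + 1) % d = i.val := congrArg Fin.val h
  have h2 := i.isLt
  rcases Nat.lt_or_ge (i.val + 1) d with h3 | h3
  · rw [Nat.mod_eq_of_lt h3] at h1; omega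
  · rw [show i.val + 1 = d by omega, Nat.mod_self] at h1; omega

theorem sgn_gen (hd : 2 ≤ d) (i : Fin d) : sgn d (gen i) = -1 := by
  change Perm.sign (root d (gen i)) = -1
  rw [root_gen, Perm.sign_swap (next_ne hd i).symm]

/-- The product of signs is a homomorphism, and each generator contributes two odd sections. This is
the upper bound for the index. -/
theorem firstLevelSign_eq_one (hd : 2 ≤ d) {g : rootedAut d} (hg : g ∈ groupG d) :
    ∏ x, sgn d (sec g x) = 1 := by
  have h : groupG d ≤ (firstLevelSign d).ker := by
    rw [groupG, Subgroup.closure_le]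
    rintro _ ⟨i, rfl⟩
    change ∏ x, sgn d (sec (gen i) x) = 1
    rw [← Finset.prod_subset (Finset.subset_univ {i, next i}),
      Finset.prod_pair (next_ne hd i).symm]
    · simp [sec_gen, sgn_gen hd]
    · intro x _ hx
      simp only [Finset.mem_insert, Finset.mem_singleton] at hx
      rw [sec_gen, if_neg hx, map_one]
  exact h hg

/-! ### Two facts on permutations -/

/-- A 3-cycle `σ` is conjugate to its square, and `τ σ τ⁻¹ = σ²` gives `⁅τ, σ⁆ = σ`. -/
theorem alternatingGroup_le_commutator (α : Type*) [Fintype α] [DecidableEq α] :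
    alternatingGroup α ≤ commutator (Perm α) := by
  rw [← Perm.closure_three_cycles_eq_alternating, Subgroup.closure_le]
  intro σ hσ
  have hσ : σ.IsThreeCycle := hσ
  obtain ⟨τ, hτ⟩ := isConj_iff.1 (Perm.isConj_iff_cycleType_eq.2
    (hσ.cycleType.trans hσ.isThreeCycle_sq.cycleType.symm))
  have h : ⁅τ, σ⁆ = σ := by rw [commutatorElement_def, hτ]; group
  rw [← h]
  exact Subgroup.commutator_mem_commutator (Subgroup.mem_top _) (Subgroup.mem_top _)

theorem exists_perm_apply_eq {α : Type*} [DecidableEq α] {x y a b : α} (hxy : x ≠ y)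
    (hab : a ≠ b) : ∃ σ : Perm α, σ x = a ∧ σ y = b := by
  -- The first swap puts `x` at `a`; the second corrects the image of `y` without touching `a`.
  refine ⟨swap (swap x a y) b * swap x a, ?_, ?_⟩
  · rw [Perm.mul_apply, swap_apply_left, swap_apply_of_ne_of_ne _ hab]
    intro h
    exact hxy ((swap x a).injective (by rw [← h, swap_apply_left]))
  · rw [Perm.mul_apply, swap_apply_left]

/-! ### The same maps on the group as a type -/

/-- The action of the group on the first level. -/
noncomputable def groupRoot (d : ℕ) : groupG d →* Perm (Fin d) := (root d).comp (groupG d).subtype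

/-- The sections of the elements of the group at the vertices of the first level. -/
noncomputable def groupSec (g : groupG d) (x : Fin d) : groupG d := ⟨sec g.1 x, sec_mem g.2 x⟩

/-- The generators, as elements of the group. -/
def groupGen (i : Fin d) : groupG d := ⟨gen i, gen_mem i⟩

/-- The sign of the permutation of the first level. -/
noncomputable def groupSgn (d : ℕ) : groupG d →* ℤˣ := Perm.sign.comp (groupRoot d)

theorem groupSec_mul (g h : groupG d) (x : Fin d) :
    groupSec (g * h) x = groupSec g (groupRoot d h x) * groupSec h x :=
  Subtype.ext (sec_mul _ _ _)

@[simp]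
theorem groupSec_one (x : Fin d) : groupSec (1 : groupG d) x = 1 := Subtype.ext (sec_one x)

theorem groupSec_inv (g : groupG d) (x : Fin d) :
    groupSec g⁻¹ x = (groupSec g ((groupRoot d g)⁻¹ x))⁻¹ := Subtype.ext (sec_inv _ _)

/-- Conjugation moves sections between vertices by the root permutation of `t`, up to conjugacy;
signs and triviality of sections are thus transported exactly. -/
theorem groupSec_conj {h : groupG d} (hh : groupRoot d h = 1) (t : groupG d) (x : Fin d) :
    groupSec (t⁻¹ * h * t) x =
      (groupSec t x)⁻¹ * groupSec h (groupRoot d t x) * groupSec t x := by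
  rw [groupSec_mul, groupSec_mul, hh, Perm.one_apply, groupSec_inv, Perm.inv_def, symm_apply_apply]

theorem groupRoot_conj {h : groupG d} (hh : groupRoot d h = 1) (t : groupG d) :
    groupRoot d (t⁻¹ * h * t) = 1 := by
  simp [hh]

/-- The sections at the vertices of the first level, on the stabilizer of this level. -/
noncomputable def stabSec (d : ℕ) : (groupRoot d).ker →* (Fin d → groupG d) where
  toFun h x := groupSec h.1 x
  map_one' := funext fun x => groupSec_one x
  map_mul' g h := funext fun x => by
    change groupSec (g.1 * h.1) x = _
    rw [groupSec_mul, h.2]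
    rfl

theorem groupRoot_groupGen (i : Fin d) : groupRoot d (groupGen i) = swap i (next i) := root_gen i

theorem groupSec_groupGen (i x : Fin d) :
    groupSec (groupGen i) x = if x = i ∨ x = next i then groupGen x else 1 := by
  refine Subtype.ext ((sec_gen i x).trans ?_)
  split_ifs <;> rfl

theorem groupSgn_groupGen (hd : 2 ≤ d) (i : Fin d) : groupSgn d (groupGen i) = -1 := sgn_gen hd i

theorem groupG_induction {p : groupG d → Prop} (hgen : ∀ i, p (groupGen i)) (hone : p 1)
    (hmul : ∀ g h, p g → p h → p (g * h)) (hinv : ∀ g, p g → p g⁻¹) (g : groupG d) : p g := by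
  obtain ⟨g, hg⟩ := g
  induction hg using Subgroup.closure_induction with
  | mem g hg => obtain ⟨i, rfl⟩ := hg; exact hgen i
  | one => exact hone
  | mul g h hg hh ihg ihh => exact hmul ⟨g, hg⟩ ⟨h, hh⟩ ihg ihh
  | inv g hg ih => exact hinv ⟨g, hg⟩ ih

/-! ### The letters in the cyclic order -/

theorem next_ofNat [NeZero d] (n : ℕ) : next (Fin.ofNat d n) = Fin.ofNat d (n + 1) :=
  Fin.ext (Nat.mod_add_mod n d 1)

theorem ofNat_add_self [NeZero d] (n : ℕ) : Fin.ofNat d (n + d) = Fin.ofNat d n :=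
  Fin.ext (Nat.add_mod_right n d)

theorem ofNat_val_eq [NeZero d] (i : Fin d) : Fin.ofNat d i.val = i :=
  Fin.ext (Nat.mod_eq_of_lt i.isLt)

/-! ### Signs of sections -/

/-- The generators that do not wrap around already induce all permutations. Their odd sections sit
exactly at the letters whose parity changes, so the signs follow the coboundary of the parity of the
letter, a rule preserved by products. -/
theorem exists_groupRoot_eq (hd : 2 ≤ d) (σ : Perm (Fin d)) :
    ∃ w : groupG d, groupRoot d w = σ ∧
      ∀ z, groupSgn d (groupSec w z) = (-1) ^ (σ z).val * (-1) ^ z.val := by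
  obtain ⟨n, rfl⟩ : ∃ n, d = n + 1 := ⟨d - 1, by omega⟩
  have hσ : σ ∈ Submonoid.closure (Set.range fun i : Fin n => swap i.castSucc i.succ) := by
    rw [Perm.mclosure_swap_castSucc_succ]
    trivial
  induction hσ using Submonoid.closure_induction with
  | mem σ hσ =>
    obtain ⟨i, rfl⟩ := hσ
    have hi : next i.castSucc = i.succ := Fin.ext (Nat.mod_eq_of_lt (by simp))
    refine ⟨groupGen i.castSucc, by rw [groupRoot_groupGen, hi], fun z => ?_⟩
    rw [groupSec_groupGen, hi]
    rcases eq_or_ne z i.castSucc with rfl | h1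
    · rw [if_pos (Or.inl rfl), groupSgn_groupGen hd, swap_apply_left, ← pow_add]
      simp only [Fin.val_succ, Fin.val_castSucc]
      exact (Odd.neg_one_pow ⟨i.val, by ring⟩).symm
    · rcases eq_or_ne z i.succ with rfl | h2
      · rw [if_pos (Or.inr rfl), groupSgn_groupGen hd, swap_apply_right, ← pow_add]
        simp only [Fin.val_succ, Fin.val_castSucc]
        exact (Odd.neg_one_pow ⟨i.val, by ring⟩).symm
      · rw [if_neg (by tauto), swap_apply_of_ne_of_ne h1 h2, map_one, ← pow_add]
        exact (Even.neg_one_pow ⟨z.val, rfl⟩).symm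
  | one =>
    refine ⟨1, map_one _, fun z => ?_⟩
    rw [groupSec_one, map_one, Perm.one_apply, ← pow_add]
    exact (Even.neg_one_pow ⟨z.val, rfl⟩).symm
  | mul σ τ _ _ ihσ ihτ =>
    obtain ⟨v, hv, hv'⟩ := ihσ
    obtain ⟨w, hw, hw'⟩ := ihτ
    refine ⟨v * w, by rw [map_mul, hv, hw], fun z => ?_⟩
    rw [groupSec_mul, map_mul, hv', hw', hw, Perm.mul_apply, mul_assoc,
      ← mul_assoc ((-1) ^ (τ z).val), ← pow_add, Even.neg_one_pow ⟨(τ z).val, rfl⟩, one_mul]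

theorem groupRoot_surjective (hd : 2 ≤ d) : Function.Surjective (groupRoot d) := fun σ =>
  let ⟨w, hw, _⟩ := exists_groupRoot_eq hd σ
  ⟨w, hw⟩

/-- The wrapping generator exchanges the last and first letters, whose parities agree because `d` is
odd, yet its sections there are odd. Comparing it with an element of the same root permutation that
obeys the parity rule leaves exactly two odd sections, which conjugation moves to `x` and `y`. -/
theorem exists_sgn_groupSec_eq (hd : 2 ≤ d) (hodd : Odd d) {x y : Fin d} (hxy : x ≠ y) :
    ∃ h : groupG d, groupRoot d h = 1 ∧
      ∀ z, groupSgn d (groupSec h z) = if z = x ∨ z = y then -1 else 1 := by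
  have : NeZero d := ⟨by omega⟩
  obtain ⟨a, ha⟩ : ∃ a : Fin d, a.val = d - 1 := ⟨⟨d - 1, by omega⟩, rfl⟩
  obtain ⟨b, hb⟩ : ∃ b : Fin d, b.val = 0 := ⟨⟨0, by omega⟩, rfl⟩
  have hab : next a = b := by
    refine Fin.ext ?_
    change (a.val + 1) % d = b.val
    rw [ha, hb, Nat.sub_add_cancel (by omega), Nat.mod_self]
  have hne : a ≠ b := fun h => next_ne hd a (hab.trans h.symm)
  have heven : Even (d - 1) := by
    obtain ⟨m, rfl⟩ := hodd
    exact ⟨m, by omega⟩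
  obtain ⟨w, hw, hw'⟩ := exists_groupRoot_eq hd (swap a b)
  have hroot : groupRoot d (w * groupGen a) = 1 := by
    rw [map_mul, hw, groupRoot_groupGen, hab, swap_mul_self]
  have hsgn : ∀ z, groupSgn d (groupSec (w * groupGen a) z) =
      if z = a ∨ z = b then -1 else 1 := by
    intro z
    rw [groupSec_mul, map_mul, hw', groupRoot_groupGen, hab, swap_apply_self, groupSec_groupGen,
      hab, ← pow_add]
    rcases eq_or_ne z a with rfl | h1
    · rw [if_pos (Or.inl rfl), if_pos (Or.inl rfl), groupSgn_groupGen hd, swap_apply_left, ha, hb,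
        add_zero, heven.neg_one_pow, one_mul]
    · rcases eq_or_ne z b with rfl | h2
      · rw [if_pos (Or.inr rfl), if_pos (Or.inr rfl), groupSgn_groupGen hd, swap_apply_right, ha,
          hb, zero_add, heven.neg_one_pow, one_mul]
      · rw [if_neg (by tauto), if_neg (by tauto), swap_apply_of_ne_of_ne h1 h2, map_one,
          Even.neg_one_pow ⟨z.val, rfl⟩, one_mul]
  obtain ⟨σ, hσx, hσy⟩ := exists_perm_apply_eq hxy hne
  obtain ⟨t, ht⟩ := groupRoot_surjective hd σ
  refine ⟨t⁻¹ * (w * groupGen a) * t, groupRoot_conj hroot t, fun z => ?_⟩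
  rw [groupSec_conj hroot, map_mul, map_mul, map_inv, mul_right_comm, inv_mul_cancel, one_mul,
    hsgn, ht, ← hσx, ← hσy]
  simp only [σ.injective.eq_iff]

/-! ### Self-replication -/

/-- `g` is the section at `x` of an element of the group that moves `x` to `y`. -/
def IsSection (x y : Fin d) (g : groupG d) : Prop :=
  ∃ h : groupG d, groupRoot d h x = y ∧ groupSec h x = g

theorem IsSection.mul {x y z : Fin d} {g h : groupG d} (hg : IsSection y z g)
    (hh : IsSection x y h) : IsSection x z (g * h) := by
  obtain ⟨g', hg1, hg2⟩ := hg
  obtain ⟨h', hh1, hh2⟩ := hh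
  exact ⟨g' * h', by rw [map_mul, Perm.mul_apply, hh1, hg1], by rw [groupSec_mul, hh1, hg2, hh2]⟩

theorem IsSection.inv {x y : Fin d} {g : groupG d} (hg : IsSection x y g) :
    IsSection y x g⁻¹ := by
  obtain ⟨g', hg1, hg2⟩ := hg
  have h : (groupRoot d g')⁻¹ y = x := by rw [← hg1, Perm.inv_def, symm_apply_apply]
  exact ⟨g'⁻¹, by rw [map_inv, h], by rw [groupSec_inv, h, hg2]⟩

theorem isSection_one (x : Fin d) : IsSection x x 1 := ⟨1, by simp, by simp⟩

theorem isSection_groupGen (i : Fin d) : IsSection i (next i) (groupGen i) :=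
  ⟨groupGen i, by rw [groupRoot_groupGen, swap_apply_left],
    by rw [groupSec_groupGen, if_pos (Or.inl rfl)]⟩

theorem isSection_groupGen_next (i : Fin d) : IsSection (next i) i (groupGen (next i)) :=
  ⟨groupGen i, by rw [groupRoot_groupGen, swap_apply_right],
    by rw [groupSec_groupGen, if_pos (Or.inr rfl)]⟩

section

variable [NeZero d]

theorem isSection_pair (n : ℕ) :
    IsSection (Fin.ofNat d n) (Fin.ofNat d n)
      (groupGen (Fin.ofNat d (n + 1)) * groupGen (Fin.ofNat d n)) := by
  rw [← next_ofNat]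
  exact (isSection_groupGen_next _).mul (isSection_groupGen _)

/-- The same element as in `isSection_pair`, now carrying `n` to `n + 2`. This double role allows
sections to be transported between vertices unchanged. -/
theorem isSection_pair_add_two (n : ℕ) :
    IsSection (Fin.ofNat d n) (Fin.ofNat d (n + 2))
      (groupGen (Fin.ofNat d (n + 1)) * groupGen (Fin.ofNat d n)) := by
  rw [← next_ofNat (n + 1), ← next_ofNat n]
  exact (isSection_groupGen _).mul (isSection_groupGen _)

theorem IsSection.of_add_two_mul {n m : ℕ} {g : groupG d}
    (hg : IsSection (Fin.ofNat d (n + 2 * m)) (Fin.ofNat d (n + 2 * m)) g) :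
    IsSection (Fin.ofNat d n) (Fin.ofNat d n) g := by
  induction m with
  | zero => exact hg
  | succ m ih =>
    refine ih ?_
    have h1 := isSection_pair (d := d) (n + 2 * m)
    have h2 := isSection_pair_add_two (d := d) (n + 2 * m)
    -- With `p` the common element of `h1` and `h2`, the path reads `p (p⁻¹ g p) p⁻¹ = g`.
    have h3 := (h1.mul ((h2.inv.mul hg).mul h2)).mul h1.inv
    convert h3 using 1
    group

theorem exists_isSection_add_two_mul (n m : ℕ) :
    ∃ w : groupG d, IsSection (Fin.ofNat d n) (Fin.ofNat d n) w ∧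
      IsSection (Fin.ofNat d n) (Fin.ofNat d (n + 2 * m)) w := by
  induction m with
  | zero => exact ⟨1, isSection_one _, isSection_one _⟩
  | succ m ih =>
    obtain ⟨w, hw, hw'⟩ := ih
    exact ⟨_, (isSection_pair (n + 2 * m)).of_add_two_mul.mul hw,
      (isSection_pair_add_two (n + 2 * m)).mul hw'⟩

end

/-- The group is self-replicating. -/
theorem isSection_self (hodd : Odd d) (x : Fin d) (g : groupG d) : IsSection x x g := by
  obtain ⟨m, rfl⟩ := hodd
  have hstep : ∀ {n : ℕ} {g : groupG (2 * m + 1)},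
      IsSection (Fin.ofNat (2 * m + 1) (n + 1)) (Fin.ofNat (2 * m + 1) (n + 1)) g →
      IsSection (Fin.ofNat (2 * m + 1) n) (Fin.ofNat (2 * m + 1) n) g := by
    intro n g hg
    -- Modulo the odd number `d`, the letter `n + 1` is reached from `n` by steps of 2.
    refine IsSection.of_add_two_mul (m := m + 1) ?_
    rw [show n + 2 * (m + 1) = n + 1 + (2 * m + 1) by ring, ofNat_add_self]
    exact hg
  have hdown : ∀ (k : ℕ) {n : ℕ} {g : groupG (2 * m + 1)},
      IsSection (Fin.ofNat (2 * m + 1) (n + k)) (Fin.ofNat (2 * m + 1) (n + k)) g →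
      IsSection (Fin.ofNat (2 * m + 1) n) (Fin.ofNat (2 * m + 1) n) g := by
    intro k
    induction k with
    | zero => exact fun hg => hg
    | succ k ih => exact fun hg => ih (hstep hg)
  have hgen : ∀ n, IsSection (Fin.ofNat (2 * m + 1) n) (Fin.ofNat (2 * m + 1) n)
      (groupGen (Fin.ofNat (2 * m + 1) (n + 2 * m))) := by
    intro n
    obtain ⟨w, hw, hw'⟩ := exists_isSection_add_two_mul (d := 2 * m + 1) n m
    -- Go from `n` back to `n` by `w⁻¹`, on to `n + 2m` by `w`, and close up with the generator
    -- there, as `n + 2m + 1 = n + d`; the `w` factors cancel.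
    have h := ((isSection_groupGen _).mul hw').mul hw.inv
    rwa [next_ofNat, mul_inv_cancel_right, add_assoc, ofNat_add_self] at h
  induction g using groupG_induction with
  | hgen i =>
    -- This index makes the generator equal to `a_i` and is at least `x`, so `hdown` can descend to
    -- `x`.
    have h := hgen (i.val + 1 + x.val * (2 * m + 1))
    have hper : ∀ j k, Fin.ofNat (2 * m + 1) (k + j * (2 * m + 1)) = Fin.ofNat (2 * m + 1) k :=
      fun j k => Fin.ext (Nat.add_mul_mod_self_right _ _ _)
    rw [show i.val + 1 + x.val * (2 * m + 1) + 2 * m = i.val + (x.val + 1) * (2 * m + 1) by ring,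
      hper (x.val + 1), ofNat_val_eq,
      show i.val + 1 + x.val * (2 * m + 1) = x.val + (i.val + 1 + x.val * (2 * m)) by ring] at h
    have h' := hdown _ h
    rwa [ofNat_val_eq] at h'
  | hone => exact isSection_one x
  | hmul g h hg hh => exact hg.mul hh
  | hinv g hg => exact hg.inv

/-! ### Normal subgroups containing the products of consecutive generators -/

/-- In the quotient, consecutive generators are mutually inverse. Going round an odd cycle makes
each its own inverse, so all coincide with one element of order at most 2, and only the sign of an
element matters. -/
theorem mem_of_groupSgn_eq_one (hd : 2 ≤ d) (hodd : Odd d) {R : Subgroup (groupG d)} [R.Normal]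
    (hR : ∀ i, groupGen (next i) * groupGen i ∈ R) {g : groupG d} (hg : groupSgn d g = 1) :
    g ∈ R := by
  have : NeZero d := ⟨by omega⟩
  let q := QuotientGroup.mk' R
  let b : ℕ → groupG d ⧸ R := fun n => q (groupGen (Fin.ofNat d n))
  have hb1 : ∀ n, b (n + 1) = (b n)⁻¹ := by
    intro n
    rw [eq_inv_iff_mul_eq_one]
    change q _ * q _ = 1
    rw [← map_mul, ← next_ofNat]
    exact (QuotientGroup.eq_one_iff _).2 (hR _)
  have hb2 : ∀ n m, b (n + 2 * m) = b n := by
    intro n m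
    induction m with
    | zero => rfl
    | succ m ih => rw [← ih, Nat.mul_succ, ← add_assoc, hb1, hb1, inv_inv]
  have hbinv : ∀ n, (b n)⁻¹ = b n := by
    intro n
    obtain ⟨m, hm⟩ := hodd
    have h1 : b (n + d) = b n := by simp only [b, ofNat_add_self]
    rwa [show n + d = n + 2 * m + 1 by omega, hb1, hb2] at h1
  have hb0 : ∀ n, b n = b 0 := by
    intro n
    induction n with
    | zero => rfl
    | succ n ih => rw [hb1, hbinv, ih]
  have hb00 : b 0 * b 0 = 1 := by
    nth_rw 1 [← hbinv 0]
    exact inv_mul_cancel _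
  have key : ∀ g, (groupSgn d g = 1 ∧ q g = 1) ∨ (groupSgn d g = -1 ∧ q g = b 0) := by
    intro g
    induction g using groupG_induction with
    | hgen i =>
      refine Or.inr ⟨groupSgn_groupGen hd i, ?_⟩
      rw [← hb0 i.val]
      simp only [b, ofNat_val_eq]
    | hone => exact Or.inl ⟨map_one _, map_one _⟩
    | hmul g h hg hh =>
      rcases hg with ⟨h1, h2⟩ | ⟨h1, h2⟩ <;> rcases hh with ⟨h3, h4⟩ | ⟨h3, h4⟩ <;>
        simp only [map_mul, h1, h2, h3, h4, hb00] <;> simp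
    | hinv g hg =>
      rcases hg with ⟨h1, h2⟩ | ⟨h1, h2⟩ <;> simp only [map_inv, h1, h2, hbinv] <;> simp
  rcases key g with ⟨_, h⟩ | ⟨h, _⟩
  · exact (QuotientGroup.eq_one_iff _).1 h
  · rw [hg] at h
    exact absurd h (by decide)

theorem eq_top_of_groupSgn_eq_neg_one (hd : 2 ≤ d) (hodd : Odd d) {R : Subgroup (groupG d)}
    [R.Normal] (hR : ∀ i, groupGen (next i) * groupGen i ∈ R) {r : groupG d} (hr : r ∈ R)
    (hr' : groupSgn d r = -1) : R = ⊤ := by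
  refine eq_top_iff.2 fun g _ => ?_
  rcases Int.units_eq_one_or (groupSgn d g) with h | h
  · exact mem_of_groupSgn_eq_one hd hodd hR h
  · have h1 : g * r ∈ R := mem_of_groupSgn_eq_one hd hodd hR (by rw [map_mul, h, hr']; decide)
    exact (Subgroup.mul_mem_cancel_right R hr).1 h1

/-! ### Squares of generators -/

theorem groupRoot_groupGen_sq (i : Fin d) : groupRoot d (groupGen i * groupGen i) = 1 := by
  rw [map_mul, groupRoot_groupGen, swap_mul_self]

theorem groupSec_groupGen_sq_self (i : Fin d) :
    groupSec (groupGen i * groupGen i) i = groupGen (next i) * groupGen i := by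
  rw [groupSec_mul, groupRoot_groupGen, swap_apply_left, groupSec_groupGen, groupSec_groupGen,
    if_pos (Or.inr rfl), if_pos (Or.inl rfl)]

theorem groupSec_groupGen_sq_of_ne {i x : Fin d} (h1 : x ≠ i) (h2 : x ≠ next i) :
    groupSec (groupGen i * groupGen i) x = 1 := by
  rw [groupSec_mul, groupRoot_groupGen, swap_apply_of_ne_of_ne h1 h2, groupSec_groupGen,
    if_neg (by tauto), one_mul]


/-! ### The first level stabilizer -/

theorem groupSec_mul_of_groupRoot_eq_one {h : groupG d} (hh : groupRoot d h = 1) (g : groupG d)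
    (x : Fin d) : groupSec (g * h) x = groupSec g x * groupSec h x := by
  rw [groupSec_mul, hh, Perm.one_apply]

theorem groupSec_inv_of_groupRoot_eq_one {h : groupG d} (hh : groupRoot d h = 1) (x : Fin d) :
    groupSec h⁻¹ x = (groupSec h x)⁻¹ := by
  rw [groupSec_inv, hh, inv_one, Perm.one_apply]

theorem groupSec_commutatorElement {g h : groupG d} (hg : groupRoot d g = 1)
    (hh : groupRoot d h = 1) (x : Fin d) :
    groupSec ⁅g, h⁆ x = ⁅groupSec g x, groupSec h x⁆ := by
  have hg' : groupRoot d g⁻¹ = 1 := by rw [map_inv, hg, inv_one]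
  have hh' : groupRoot d h⁻¹ = 1 := by rw [map_inv, hh, inv_one]
  rw [commutatorElement_def, groupSec_mul_of_groupRoot_eq_one hh',
    groupSec_mul_of_groupRoot_eq_one hg', groupSec_mul_of_groupRoot_eq_one hh,
    groupSec_inv_of_groupRoot_eq_one hh, groupSec_inv_of_groupRoot_eq_one hg, commutatorElement_def]

/-- The subgroup of the sections at `x` of the elements of the first level stabilizer. -/
noncomputable def stabSections (x : Fin d) : Subgroup (groupG d) where
  carrier := {g | ∃ h : groupG d, groupRoot d h = 1 ∧ groupSec h x = g}
  one_mem' := ⟨1, map_one _, groupSec_one x⟩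
  mul_mem' := by
    rintro _ _ ⟨g, hg, rfl⟩ ⟨h, hh, rfl⟩
    exact ⟨g * h, by rw [map_mul, hg, hh, one_mul], groupSec_mul_of_groupRoot_eq_one hh g x⟩
  inv_mem' := by
    rintro _ ⟨g, hg, rfl⟩
    exact ⟨g⁻¹, by rw [map_inv, hg, inv_one], groupSec_inv_of_groupRoot_eq_one hg x⟩

theorem stabSections_normal (hodd : Odd d) (x : Fin d) : (stabSections x).Normal := by
  refine ⟨?_⟩
  rintro _ ⟨h, hh, rfl⟩ g
  obtain ⟨t, ht, ht'⟩ := isSection_self hodd x g⁻¹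
  exact ⟨t⁻¹ * h * t, groupRoot_conj hh t, by rw [groupSec_conj hh, ht, ht', inv_inv]⟩

/-- Conjugates of `a_i²` supply every `a_{i+1} a_i`, by normality, and `exists_sgn_groupSec_eq`
supplies an odd section. -/
theorem stabSections_eq_top (hd : 2 ≤ d) (hodd : Odd d) (x : Fin d) : stabSections x = ⊤ := by
  have hN := stabSections_normal hodd x
  obtain ⟨k, hk, hk'⟩ := exists_sgn_groupSec_eq hd hodd (next_ne hd x).symm
  refine eq_top_of_groupSgn_eq_neg_one hd hodd (fun i => ?_) (r := groupSec k x) ⟨k, hk, rfl⟩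
    (by rw [hk', if_pos (Or.inl rfl)])
  obtain ⟨t, ht⟩ := groupRoot_surjective hd (swap x i)
  have h : groupSec (t⁻¹ * (groupGen i * groupGen i) * t) x ∈ stabSections x :=
    ⟨_, groupRoot_conj (groupRoot_groupGen_sq i) t, rfl⟩
  rw [groupSec_conj (groupRoot_groupGen_sq i), ht, swap_apply_left,
    groupSec_groupGen_sq_self] at h
  convert hN.conj_mem _ h (groupSec t x) using 1
  group

/-! ### Stabilizer elements supported on two vertices -/

/-- The subgroup of the sections at `x` of the elements of the first level stabilizer whose
sections are trivial except at `x` and `y`. -/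
noncomputable def pairSections (x y : Fin d) : Subgroup (groupG d) where
  carrier := {g | ∃ h : groupG d, groupRoot d h = 1 ∧ groupSec h x = g ∧
    ∀ z, z ≠ x → z ≠ y → groupSec h z = 1}
  one_mem' := ⟨1, map_one _, groupSec_one x, fun z _ _ => groupSec_one z⟩
  mul_mem' := by
    rintro _ _ ⟨g, hg, rfl, hg'⟩ ⟨h, hh, rfl, hh'⟩
    refine ⟨g * h, by rw [map_mul, hg, hh, one_mul], groupSec_mul_of_groupRoot_eq_one hh g x,
      fun z hx hy => ?_⟩
    rw [groupSec_mul_of_groupRoot_eq_one hh, hg' z hx hy, hh' z hx hy, one_mul]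
  inv_mem' := by
    rintro _ ⟨g, hg, rfl, hg'⟩
    refine ⟨g⁻¹, by rw [map_inv, hg, inv_one], groupSec_inv_of_groupRoot_eq_one hg x,
      fun z hx hy => ?_⟩
    rw [groupSec_inv_of_groupRoot_eq_one hg, hg' z hx hy, inv_one]

/-- The conjugator is taken in the first level stabilizer, with prescribed section at `x`, so the
support does not move. -/
theorem pairSections_normal (hd : 2 ≤ d) (hodd : Odd d) (x y : Fin d) :
    (pairSections x y).Normal := by
  refine ⟨?_⟩
  rintro _ ⟨h, hh, rfl, hh'⟩ g
  obtain ⟨t, ht, ht'⟩ : g⁻¹ ∈ stabSections x := by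
    rw [stabSections_eq_top hd hodd]
    trivial
  refine ⟨t⁻¹ * h * t, groupRoot_conj hh t, ?_, fun z hx hy => ?_⟩
  · rw [groupSec_conj hh, ht, ht', inv_inv, Perm.one_apply]
  · rw [groupSec_conj hh, ht, Perm.one_apply, hh' z hx hy, mul_one, inv_mul_cancel]

theorem mul_groupGen_mem_pairSections (hd : 2 ≤ d) (hodd : Odd d) {x y : Fin d} (hxy : x ≠ y)
    (i : Fin d) : groupGen (next i) * groupGen i ∈ pairSections x y := by
  have hN := pairSections_normal hd hodd x y
  obtain ⟨σ, hσx, hσy⟩ := exists_perm_apply_eq hxy (next_ne hd i).symm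
  obtain ⟨t, ht⟩ := groupRoot_surjective hd σ
  have h : groupSec (t⁻¹ * (groupGen i * groupGen i) * t) x ∈ pairSections x y := by
    refine ⟨_, groupRoot_conj (groupRoot_groupGen_sq i) t, rfl, fun z hx hy => ?_⟩
    rw [groupSec_conj (groupRoot_groupGen_sq i), ht, groupSec_groupGen_sq_of_ne, mul_one,
      inv_mul_cancel]
    · rw [← hσx]; exact σ.injective.ne hx
    · rw [← hσy]; exact σ.injective.ne hy
  rw [groupSec_conj (groupRoot_groupGen_sq i), ht, hσx, groupSec_groupGen_sq_self] at h
  convert hN.conj_mem _ h (groupSec t x) using 1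
  group

/-- Even sections already lie in `pairSections`. An odd one comes from an element with odd sections
only at `x` and `y`: its even sections at the other vertices `w` are cancelled one by one by
elements supported on `{w, y}`. -/
theorem pairSections_eq_top (hd : 2 ≤ d) (hodd : Odd d) {x y : Fin d} (hxy : x ≠ y) :
    pairSections x y = ⊤ := by
  -- Nothing is required at `y`, which absorbs the side effects of the cancellations.
  have key : ∀ s : Finset (Fin d), x ∉ s → y ∉ s → ∃ k : groupG d, groupRoot d k = 1 ∧
      groupSgn d (groupSec k x) = -1 ∧
      (∀ z, z ≠ x → z ≠ y → groupSgn d (groupSec k z) = 1) ∧ ∀ z ∈ s, groupSec k z = 1 := by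
    intro s
    induction s using Finset.induction_on with
    | empty =>
      intro _ _
      obtain ⟨k, hk, hk'⟩ := exists_sgn_groupSec_eq hd hodd hxy
      exact ⟨k, hk, by rw [hk', if_pos (Or.inl rfl)],
        fun z hx hy => by rw [hk', if_neg (by tauto)], by simp⟩
    | insert w s hw ih =>
      intro hx hy
      rw [Finset.mem_insert, not_or] at hx hy
      obtain ⟨k, hk, hkx, hksgn, hks⟩ := ih hx.2 hy.2
      have hwy : w ≠ y := fun h => hy.1 h.symm
      have hN := pairSections_normal hd hodd w y
      obtain ⟨h, hh, hhw, hh'⟩ : (groupSec k w)⁻¹ ∈ pairSections w y :=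
        mem_of_groupSgn_eq_one hd hodd (mul_groupGen_mem_pairSections hd hodd hwy)
          (by rw [map_inv, hksgn w (fun h => hx.1 h.symm) hwy, inv_one])
      have hsec : ∀ z, z ≠ w → z ≠ y → groupSec (k * h) z = groupSec k z := fun z hzw hzy => by
        rw [groupSec_mul_of_groupRoot_eq_one hh, hh' z hzw hzy, mul_one]
      have hsecw : groupSec (k * h) w = 1 := by
        rw [groupSec_mul_of_groupRoot_eq_one hh, hhw, mul_inv_cancel]
      refine ⟨k * h, by rw [map_mul, hk, hh, one_mul], by rw [hsec x hx.1 hxy, hkx],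
        fun z hzx hzy => ?_, fun z hz => ?_⟩
      · rcases eq_or_ne z w with rfl | hzw
        · rw [hsecw, map_one]
        · rw [hsec z hzw hzy, hksgn z hzx hzy]
      · rcases Finset.mem_insert.1 hz with rfl | hz
        · exact hsecw
        · rw [hsec z (fun h => hw (h ▸ hz)) (fun h => hy.2 (h ▸ hz)), hks z hz]
  obtain ⟨k, hk, hkx, -, hk'⟩ := key (Finset.univ \ {x, y}) (by simp) (by simp)
  have hN := pairSections_normal hd hodd x y
  exact eq_top_of_groupSgn_eq_neg_one hd hodd (mul_groupGen_mem_pairSections hd hodd hxy)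
    ⟨k, hk, rfl, fun z hx hy => hk' z (by simp [hx, hy])⟩ hkx

/-! ### The commutator subgroup -/

/-- The tuples of sections of the elements of the commutator subgroup that lie in the first level
stabilizer. -/
noncomputable def commutatorSections (d : ℕ) : Subgroup (Fin d → groupG d) :=
  ((commutator (groupG d)).subgroupOf (groupRoot d).ker).map (stabSec d)

theorem mem_commutatorSections {c : Fin d → groupG d} :
    c ∈ commutatorSections d ↔ ∃ k ∈ commutator (groupG d), groupRoot d k = 1 ∧
      ∀ x, groupSec k x = c x := by
  constructor
  · rintro ⟨k, hk, rfl⟩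
    exact ⟨k.1, hk, k.2, fun x => rfl⟩
  · rintro ⟨k, hk, hk1, hkc⟩
    exact ⟨⟨k, hk1⟩, hk, funext hkc⟩

theorem exists_ne_ne (hd : 3 ≤ d) (x y : Fin d) : ∃ z, z ≠ x ∧ z ≠ y := by
  obtain ⟨z, hz⟩ := Finset.exists_mem_notMem_of_card_lt_card (s := {x, y}) (t := Finset.univ)
    (lt_of_le_of_lt Finset.card_le_two (by rw [Finset.card_univ, Fintype.card_fin]; omega))
  exact ⟨z, by simpa using hz⟩

/-- Supports `{x, y}` and `{x, z}` meet only in `x`, so the commutator is trivial elsewhere; three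
distinct letters are needed. -/
theorem mulSingle_mem_commutatorSections (hd : 3 ≤ d) (hodd : Odd d) (x : Fin d) {c : groupG d}
    (hc : c ∈ commutator (groupG d)) : Pi.mulSingle x c ∈ commutatorSections d := by
  have h : commutator (groupG d) ≤
      (commutatorSections d).comap (MonoidHom.mulSingle (fun _ : Fin d => groupG d) x) := by
    refine Subgroup.commutator_le.2 fun g _ h _ => ?_
    obtain ⟨y, hyx, -⟩ := exists_ne_ne hd x x
    obtain ⟨z, hzx, hzy⟩ := exists_ne_ne hd x y
    obtain ⟨u, hu, hux, hu'⟩ : g ∈ pairSections x y := by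
      rw [pairSections_eq_top (by omega) hodd hyx.symm]; trivial
    obtain ⟨v, hv, hvx, hv'⟩ : h ∈ pairSections x z := by
      rw [pairSections_eq_top (by omega) hodd hzx.symm]; trivial
    refine mem_commutatorSections.2 ⟨⁅u, v⁆,
      Subgroup.commutator_mem_commutator (Subgroup.mem_top _) (Subgroup.mem_top _),
      by rw [map_commutatorElement, hu, commutatorElement_one_left], fun w => ?_⟩
    rw [groupSec_commutatorElement hu hv, MonoidHom.mulSingle_apply]
    rcases eq_or_ne w x with rfl | hwx
    · rw [hux, hvx, Pi.mulSingle_eq_same]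
    · rw [Pi.mulSingle_eq_of_ne hwx]
      rcases eq_or_ne w y with rfl | hwy
      · rw [hv' w hwx hzy.symm, commutatorElement_one_right]
      · rw [hu' w hwx hwy, commutatorElement_one_left]
  exact h hc

theorem mem_commutatorSections_of_forall_mem (hd : 3 ≤ d) (hodd : Odd d) {c : Fin d → groupG d}
    (hc : ∀ x, c x ∈ commutator (groupG d)) : c ∈ commutatorSections d :=
  Subgroup.pi_mem_of_mulSingle_mem _ fun x => mulSingle_mem_commutatorSections hd hodd x (hc x)

/-- The map that takes the signs of a tuple of elements. -/
noncomputable def signTuple (d : ℕ) : (Fin d → groupG d) →* (Fin d → ℤˣ) :=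
  (groupSgn d).compLeft (Fin d)

/-- If `p` has odd sections exactly at `w` and `x`, and `t` exchanges `x` and `y`, then `t⁻¹ p t`
has them at `w` and `y`; in `⁅t⁻¹, p⁆` the signs at `w` cancel. -/
theorem pair_mem_map_signTuple (hd : 3 ≤ d) (hodd : Odd d) {x y : Fin d} (hxy : x ≠ y) :
    Pi.mulSingle x (-1) * Pi.mulSingle y (-1) ∈ (commutatorSections d).map (signTuple d) := by
  obtain ⟨w, hwx, hwy⟩ := exists_ne_ne hd x y
  obtain ⟨p, hp, hp'⟩ := exists_sgn_groupSec_eq (by omega) hodd hwx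
  obtain ⟨t, ht⟩ := groupRoot_surjective (by omega) (swap x y)
  refine ⟨fun z => groupSec ⁅t⁻¹, p⁆ z, mem_commutatorSections.2 ⟨⁅t⁻¹, p⁆,
    Subgroup.commutator_mem_commutator (Subgroup.mem_top _) (Subgroup.mem_top _),
    by rw [map_commutatorElement, hp, commutatorElement_one_right], fun z => rfl⟩, ?_⟩
  funext z
  have hpi : groupRoot d p⁻¹ = 1 := by rw [map_inv, hp, inv_one]
  change groupSgn d (groupSec (t⁻¹ * p * t⁻¹⁻¹ * p⁻¹) z) = _
  rw [inv_inv, groupSec_mul_of_groupRoot_eq_one hpi, groupSec_conj hp,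
    groupSec_inv_of_groupRoot_eq_one hp, ht]
  simp only [map_mul, map_inv, hp']
  rw [mul_right_comm (groupSgn d _)⁻¹, inv_mul_cancel, one_mul, Pi.mul_apply]
  rcases eq_or_ne z x with rfl | hzx
  · rw [swap_apply_left, Pi.mulSingle_eq_same, Pi.mulSingle_eq_of_ne hxy,
      if_neg (by simp [hwy.symm, hxy.symm]), if_pos (Or.inr rfl)]
    rfl
  · rcases eq_or_ne z y with rfl | hzy
    · rw [swap_apply_right, Pi.mulSingle_eq_same, Pi.mulSingle_eq_of_ne hxy.symm,
        if_pos (Or.inr rfl), if_neg (by simp [hwy.symm, hxy.symm])]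
      rfl
    · rw [swap_apply_of_ne_of_ne hzx hzy, Pi.mulSingle_eq_of_ne hzx, Pi.mulSingle_eq_of_ne hzy,
        mul_inv_cancel, one_mul]

theorem mem_map_signTuple (hd : 3 ≤ d) (hodd : Odd d) {ε : Fin d → ℤˣ} (hε : ∏ x, ε x = 1) :
    ε ∈ (commutatorSections d).map (signTuple d) := by
  have x₀ : Fin d := ⟨0, by omega⟩
  -- The extra factors at `x₀` multiply to `∏ x, ε x = 1`.
  have h : ∏ x, (Pi.mulSingle x (ε x) * Pi.mulSingle x₀ (ε x)) = ε := by
    rw [Finset.prod_mul_distrib, Finset.univ_prod_mulSingle]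
    have h1 := map_prod (MonoidHom.mulSingle (fun _ : Fin d => ℤˣ) x₀) ε Finset.univ
    rw [hε, map_one] at h1
    simp only [MonoidHom.mulSingle_apply] at h1
    rw [← h1, mul_one]
  rw [← h]
  refine Subgroup.prod_mem _ fun x _ => ?_
  rcases Int.units_eq_one_or (ε x) with h1 | h1
  · rw [h1, Pi.mulSingle_one, Pi.mulSingle_one, one_mul]
    exact one_mem _
  · rw [h1]
    rcases eq_or_ne x x₀ with rfl | hx
    · rw [← Pi.mulSingle_mul, Int.units_mul_self, Pi.mulSingle_one]
      exact one_mem _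
    · exact pair_mem_map_signTuple hd hodd hx

theorem exists_mem_commutator_groupRoot_eq (hd : 2 ≤ d) {σ : Perm (Fin d)}
    (hσ : Perm.sign σ = 1) : ∃ c ∈ commutator (groupG d), groupRoot d c = σ := by
  have h : commutator (Perm (Fin d)) ≤ (commutator (groupG d)).map (groupRoot d) :=
    Subgroup.commutator_le_map_commutator
      (le_of_eq (Subgroup.map_top_of_surjective _ (groupRoot_surjective hd)).symm)
      (le_of_eq (Subgroup.map_top_of_surjective _ (groupRoot_surjective hd)).symm)
  exact h (alternatingGroup_le_commutator _ (Perm.mem_alternatingGroup.2 hσ))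

/-- Match the signs first; the remaining discrepancy at each vertex is an even permutation, induced
by an element of `G'`, and such corrections may be made independently. -/
theorem exists_mem_commutator_groupRoot_groupSec_eq (hd : 3 ≤ d) (hodd : Odd d)
    {τ : Fin d → Perm (Fin d)} (hτ : ∏ x, Perm.sign (τ x) = 1) :
    ∃ k ∈ commutator (groupG d), groupRoot d k = 1 ∧
      ∀ x, groupRoot d (groupSec k x) = τ x := by
  obtain ⟨c, hc, hcτ⟩ := mem_map_signTuple hd hodd hτ
  have hcτ' : ∀ x, Perm.sign (groupRoot d (c x)) = Perm.sign (τ x) := congrFun hcτ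
  choose b hb hb' using fun x => exists_mem_commutator_groupRoot_eq (d := d) (by omega)
    (σ := τ x * (groupRoot d (c x))⁻¹)
    (by rw [map_mul, map_inv, hcτ', mul_inv_cancel])
  obtain ⟨k, hk, hk1, hk2⟩ := mem_commutatorSections.1
    (mul_mem (mem_commutatorSections_of_forall_mem hd hodd hb) hc)
  refine ⟨k, hk, hk1, fun x => ?_⟩
  rw [hk2, Pi.mul_apply, map_mul, hb', inv_mul_cancel_right]

/-! ### Labels of the level stabilizers -/

theorem apply_eq_self_of_sec {g : rootedAut d} (hg : root d g = 1) {k : ℕ}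
    (h : ∀ x u, u.length = k → (sec g x).1 u = u) (u : List (Fin d)) (hu : u.length = k + 1) :
    g.1 u = u := by
  obtain ⟨x, u, rfl⟩ := List.exists_of_length_succ u hu
  rw [apply_cons, hg, Perm.one_apply, h x u (by simpa using hu)]

/-- Keeping the witness in `G'` makes the induction work: the elements found for the `d` subtrees
can be assembled into one element of `G'`. -/
theorem exists_mem_commutator_label_eq (hd : 3 ≤ d) (hodd : Odd d) (n : ℕ)
    (τ : List (Fin d) → Perm (Fin d))
    (hτ : ∀ u, u.length = n → ∏ x, Perm.sign (τ (u ++ [x])) = 1) :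
    ∃ k ∈ commutator (groupG d), (∀ u, u.length = n + 1 → k.1.1 u = u) ∧
      ∀ u x, u.length = n → root d (sectionAt k.1 (u ++ [x])) = τ (u ++ [x]) := by
  induction n generalizing τ with
  | zero =>
    obtain ⟨k, hk, hk1, hk2⟩ := exists_mem_commutator_groupRoot_groupSec_eq hd hodd
      (τ := fun x => τ [x]) (hτ [] rfl)
    refine ⟨k, hk, apply_eq_self_of_sec hk1 fun x u hu => ?_, fun u x hu => ?_⟩
    · obtain rfl := List.eq_nil_of_length_eq_zero hu
      exact (sec k.1 x).2
    · obtain rfl := List.eq_nil_of_length_eq_zero hu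
      exact hk2 x
  | succ n ih =>
    choose c hc hc1 hc2 using fun y => ih (fun u => τ (y :: u)) fun u hu =>
      hτ (y :: u) (by rw [List.length_cons, hu])
    obtain ⟨k, hk, hk1, hk2⟩ := mem_commutatorSections.1
      (mem_commutatorSections_of_forall_mem hd hodd hc)
    have hsec : ∀ x, sec k.1 x = (c x).1 := fun x => congrArg Subtype.val (hk2 x)
    refine ⟨k, hk, apply_eq_self_of_sec hk1 fun x u hu => ?_, fun u x hu => ?_⟩
    · exact (congrArg (fun s => s.1 u) (hsec x)).trans (hc1 x u hu)
    · obtain ⟨y, u, rfl⟩ := List.exists_of_length_succ u hu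
      rw [List.cons_append, ← hc2 y u x (by simpa using hu), ← hsec]
      rfl

/-- The permutations at the vertices of level `n + 1`, on the stabilizer of this level. -/
noncomputable def labels (d n : ℕ) :
    levelStabilizer (groupG d) (n + 1) →* (List.Vector (Fin d) n → Fin d → Perm (Fin d)) where
  toFun g u x := root d (sectionAt g.1 (u.1 ++ [x]))
  map_one' := by
    funext u x
    refine Equiv.ext fun y => ?_
    have h : (1 : rootedAut d).1 (u.1 ++ [x] ++ [y]) = _ := apply_append _ _ _
    rw [apply_cons] at h
    have h' := List.append_cancel_left (show u.1 ++ [x] ++ [y] = u.1 ++ [x] ++ _ from h)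
    exact (List.cons.inj h').1.symm
  map_mul' g h := by
    funext u x
    change root d (sectionAt (g.1 * h.1) (u.1 ++ [x])) = _
    -- The cocycle rule for sections becomes multiplicative because `h` fixes the word `u x`.
    rw [sectionAt_mul, h.2.2 _ (by simp), map_mul]
    rfl

theorem labels_ker (hd : 0 < d) (n : ℕ) : (labels d n).ker =
    (levelStabilizer (groupG d) (n + 2)).subgroupOf (levelStabilizer (groupG d) (n + 1)) := by
  have : NeZero d := ⟨hd.ne'⟩
  have key : ∀ (g : levelStabilizer (groupG d) (n + 1)) (u : List (Fin d)), u.length = n →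
      ∀ x y, g.1.1 (u ++ [x] ++ [y]) = u ++ [x] ++ [root d (sectionAt g.1 (u ++ [x])) y] := by
    intro g u hu x y
    rw [apply_append, g.2.2 _ (by simp [hu]), apply_cons,
      show (sec (sectionAt g.1 (u ++ [x])) y).1 [] = [] from (sec _ y).2]
  ext g
  rw [MonoidHom.mem_ker, Subgroup.mem_subgroupOf]
  constructor
  · intro h
    refine ⟨g.2.1, fun v hv => ?_⟩
    rcases List.eq_nil_or_concat' v with rfl | ⟨v, y, rfl⟩
    · simp at hv
    rcases List.eq_nil_or_concat' v with rfl | ⟨u, x, rfl⟩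
    · simp at hv
    have hu : u.length = n := by simpa using hv
    have h1 : root d (sectionAt g.1 (u ++ [x])) = 1 := congrFun (congrFun h ⟨u, hu⟩) x
    rw [key g u hu, h1, Perm.one_apply]
  · intro h
    funext u x
    refine Equiv.ext fun y => ?_
    have h1 := key g u.1 u.2 x y
    rw [h.2 _ (by simp)] at h1
    exact (List.cons.inj (List.append_cancel_left h1)).1.symm

/-! ### Counting labels and computing indices -/

/-- The tuples of permutations whose product is even. -/
def evenTuples (d : ℕ) : Subgroup (Fin d → Perm (Fin d)) :=
  MonoidHom.ker
    { toFun := fun τ => ∏ x, Perm.sign (τ x)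
      map_one' := by simp
      map_mul' := fun σ τ => by simp [Finset.prod_mul_distrib] : (Fin d → Perm (Fin d)) →* ℤˣ }

theorem mem_evenTuples {τ : Fin d → Perm (Fin d)} :
    τ ∈ evenTuples d ↔ ∏ x, Perm.sign (τ x) = 1 := Iff.rfl

theorem card_evenTuples (hd : 2 ≤ d) : 2 * Nat.card (evenTuples d) = d.factorial ^ d := by
  have h := (evenTuples d).index_mul_card
  rw [Nat.card_eq_fintype_card (α := Fin d → Perm (Fin d)), Fintype.card_fun, Fintype.card_perm,
    Fintype.card_fin] at h
  rw [← h, evenTuples, Subgroup.index_ker, MonoidHom.range_eq_top.2, Subgroup.card_top,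
    Nat.card_eq_fintype_card (α := ℤˣ), Fintype.card_units_int]
  intro ε
  have x₀ : Fin d := ⟨0, by omega⟩
  rcases Int.units_eq_one_or ε with rfl | rfl
  · exact ⟨1, map_one _⟩
  · refine ⟨Pi.mulSingle x₀ (swap x₀ (next x₀)), ?_⟩
    change ∏ x, Perm.sign (Pi.mulSingle (M := fun _ => Perm (Fin d)) x₀ (swap x₀ (next x₀)) x) = -1
    rw [Finset.prod_eq_single x₀ _ (by simp), Pi.mulSingle_eq_same,
      Perm.sign_swap (next_ne hd _).symm]
    intro x _ hx
    rw [Pi.mulSingle_eq_of_ne hx, map_one]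

theorem labels_range (hd : 3 ≤ d) (hodd : Odd d) (n : ℕ) :
    (labels d n).range = Subgroup.pi Set.univ fun _ => evenTuples d := by
  ext τ
  rw [Subgroup.mem_pi]
  constructor
  · rintro ⟨g, rfl⟩ u -
    have h := firstLevelSign_eq_one (by omega) (sectionAt_mem g.2.1 u.1)
    rw [mem_evenTuples, ← h]
    refine Finset.prod_congr rfl fun x _ => ?_
    change Perm.sign (root d (sectionAt g.1 (u.1 ++ [x]))) = _
    rw [sectionAt_append]
    rfl
  · intro h
    have hlen : ∀ (u : List (Fin d)) (x : Fin d), (u ++ [x]).dropLast = u := by simp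
    have x₀ : Fin d := ⟨0, by omega⟩
    -- Only words of length `n + 1` matter; the default letter and the value 1 elsewhere play no
    -- role.
    let τ' : List (Fin d) → Perm (Fin d) := fun v =>
      if hv : v.dropLast.length = n then τ ⟨v.dropLast, hv⟩ (v.getLastD x₀) else 1
    have hτ' : ∀ (u : List (Fin d)) (hu : u.length = n) (x : Fin d),
        τ' (u ++ [x]) = τ ⟨u, hu⟩ x := by
      intro u hu x
      simp [τ', hu]
    obtain ⟨k, -, hk1, hk2⟩ := exists_mem_commutator_label_eq hd hodd n τ' fun u hu => by
      simp only [hτ' u hu]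
      exact h ⟨u, hu⟩ trivial
    refine ⟨⟨k.1, k.2, hk1⟩, ?_⟩
    funext u x
    exact (hk2 u.1 x u.2).trans (hτ' u.1 u.2 x)

theorem relIndex_levelStabilizer_succ (hd : 3 ≤ d) (hodd : Odd d) (n : ℕ) :
    2 ^ d ^ n * (levelStabilizer (groupG d) (n + 2)).relIndex (levelStabilizer (groupG d) (n + 1)) =
      d.factorial ^ d ^ (n + 1) := by
  have hcard : Nat.card (Subgroup.pi (Set.univ : Set (List.Vector (Fin d) n))
      fun _ => evenTuples d) = Nat.card (evenTuples d) ^ d ^ n := by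
    change Nat.card (Set.univ.pi fun _ : List.Vector (Fin d) n => (evenTuples d : Set (Fin d → Perm (Fin d)))) = _
    rw [Nat.card_congr (Equiv.Set.univPi _), Nat.card_fun,
      Nat.card_eq_fintype_card (α := List.Vector _ _), card_vector, Fintype.card_fin]
    rfl
  rw [Subgroup.relIndex, ← labels_ker (by omega), Subgroup.index_ker, labels_range hd hodd, hcard,
    ← mul_pow, card_evenTuples (by omega), ← pow_mul, pow_succ']

theorem relIndex_levelStabilizer_one (hd : 2 ≤ d) :
    (levelStabilizer (groupG d) 1).relIndex (groupG d) = d.factorial := by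
  have h : levelStabilizer (groupG d) 1 = (root d).ker ⊓ groupG d := by
    ext g
    rw [Subgroup.mem_inf, MonoidHom.mem_ker]
    constructor
    · intro hg
      refine ⟨Equiv.ext fun x => ?_, hg.1⟩
      have h1 := apply_cons g x []
      rw [hg.2 [x] rfl] at h1
      exact (List.cons.inj h1).1.symm
    · rintro ⟨hg, hg'⟩
      refine ⟨hg', apply_eq_self_of_sec hg fun x u hu => ?_⟩
      obtain rfl := List.eq_nil_of_length_eq_zero hu
      exact (sec g x).2
  have hmap : (groupG d).map (root d) = ⊤ := by
    refine eq_top_iff.2 fun σ _ => ?_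
    obtain ⟨g, hg⟩ := groupRoot_surjective hd σ
    exact ⟨g.1, g.2, hg⟩
  rw [h, Subgroup.inf_relIndex_right, Subgroup.relIndex_ker, hmap, Subgroup.card_top,
    Nat.card_eq_fintype_card, Fintype.card_perm, Fintype.card_fin]

theorem relIndex_levelStabilizer (hd : 3 ≤ d) (hodd : Odd d) (n : ℕ) :
    2 ^ (∑ i ∈ Finset.range n, d ^ i) *
        (levelStabilizer (groupG d) (n + 1)).relIndex (groupG d) =
      d.factorial ^ (∑ i ∈ Finset.range (n + 1), d ^ i) := by
  have : NeZero d := ⟨by omega⟩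
  induction n with
  | zero => simpa using relIndex_levelStabilizer_one (d := d) (by omega)
  | succ n ih =>
    rw [← Subgroup.relIndex_mul_relIndex _ _ _ (levelStabilizer_succ_le (groupG d) (n + 1))
      (levelStabilizer_le (groupG d) (n + 1)), Finset.sum_range_succ _ (n + 1),
      pow_add d.factorial, ← ih, ← relIndex_levelStabilizer_succ hd hodd n,
      Finset.sum_range_succ _ n, pow_add]
    ring

end TreeAut

theorem mainTheorem10 (d : ℕ) (hd : 3 ≤ d) (hodd : Odd d) (k : ℕ) (hk : 1 ≤ k) :
    (((TreeAut.levelStabilizer (TreeAut.groupG d) (k + 1)).relIndex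
          (TreeAut.levelStabilizer (TreeAut.groupG d) k) : ℕ) : ℚ)
        = (d.factorial : ℚ) ^ (d ^ k) / 2 ^ (d ^ (k - 1)) ∧
      (((TreeAut.levelStabilizer (TreeAut.groupG d) (k + 1)).relIndex
          (TreeAut.groupG d) : ℕ) : ℚ)
        = (d.factorial : ℚ) ^ ((d ^ (k + 1) - 1) / (d - 1)) / 2 ^ ((d ^ k - 1) / (d - 1)) := by
  obtain ⟨n, rfl⟩ : ∃ n, k = n + 1 := ⟨k - 1, by omega⟩
  constructor
  · rw [eq_div_iff (by positivity), mul_comm]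
    exact_mod_cast TreeAut.relIndex_levelStabilizer_succ hd hodd n
  -- The natural-number divisions in the exponents are exact: they are geometric sums.
  · rw [← Nat.geomSum_eq (by omega), ← Nat.geomSum_eq (by omega), eq_div_iff (by positivity),
      mul_comm]
    exact_mod_cast TreeAut.relIndex_levelStabilizer hd hodd (n + 1)
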